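/- Let $(Z,\mathfrak Z)$ be an arbitrary measurable space (no topological assumptions) with a $\sigma$-finite measure $\nu$. Let $\mathcal M$ be the space of all countable sums of $\mathbb N$-valued measures on $Z$, with the $\sigma$-algebra generated by the maps $\xi\mapsto\xi(B)$, $B\in\mathfrak Z$, and let $\Pi$ be the law of the Poisson point process with intensity $\nu$, that is, the probability on $\mathcal M$ such that, for all measurable $u\colon\mathcal M\times Z\to[0,\infty]$, $$\int\!\!\int u(\eta,z)\,\eta(\mathrm dz)\,\Pi(\mathrm d\eta)=\int\!\!\int u(\eta+\delta_z,z)\,\Pi(\mathrm d\eta)\,\nu(\mathrm dz).$$ For measurable $F\colon\mathcal M\to\mathbb R$ put $D^+_zF(\eta)=F(\eta+\delta_z)-F(\eta)$ and $D^-_zF(\eta)=(F(\eta)-F(\eta-\delta_z))1_{z\in\eta}$, where $z\in\eta$ means $\delta_z\le\eta$. Here $D^-F$ is understood up to modification on sets not charged by $\eta(\mathrm dz)\Pi(\mathrm d\eta)$: a representative of $D^-F$ is a function $u$ on $\mathcal M\times Z$ for which there is a measurable function $v$ on $\mathcal M\times Z$ with $v(\eta,z)=D^-_zF(\eta)$ whenever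 $z\in\eta$, and such that, for $\Pi$-almost every $\eta$, $u(\eta,z)=v(\eta,z)$ for $\eta$-almost every $z$. Let $\operatorname{dom}D$ be the set of measurable $F\in\mathcal L^2(\Pi)$ with $\int\!\int(D^+_zF(\eta))^2\,\Pi(\mathrm d\eta)\,\nu(\mathrm dz)<\infty$. For $F,G\in\operatorname{dom}D$ let $\mathcal E(F,G)=\int\!\int D^+_zF\,D^+_zG\,\mathrm d\Pi\,\mathrm d\nu$, and let $\mathcal A=\operatorname{dom}D\cap\mathcal L^\infty(\Pi)$. For $F,\Phi\in\mathcal A$ let $$\boldsymbol\Gamma(F)[\Phi]=\mathcal E(F,F\Phi)-\tfrac12\mathcal E(F^2,\Phi).$$ For $F\in\operatorname{dom}D$ and $\Phi\in\mathcal A$, $\boldsymbol\Gamma(F)[\Phi]$ is defined by continuous extension: it is the common limit of $\boldsymbol\Gamma(F_n)[\Phi]$ along all sequences $(F_n)$ in $\mathcal A$ with $\Pi((F_n-F)^2)+\mathcal E(F_n-F,F_n-F)\to0$ (such sequences being required to exist). Let $\operatorname{dom}\Gamma$ be the set of $F\in\operatorname{dom}D$ for which there is a non-negative $\Gamma(F)\in\mathcal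 L^1(\Pi)$ such that, for every $\Phi\in\mathcal A$, $\boldsymbol\Gamma(F)[\Phi]$ is defined and equals $\int\Gamma(F)\,\Phi\,\mathrm d\Pi$. Then $\operatorname{dom}\Gamma=\operatorname{dom}D$. Moreover, for every $F\in\operatorname{dom}D$, the function $D^-F$ has a representative; $D^-F$ is a representative of itself if, for $\Pi$-almost every $\eta$, $z\in\eta$ holds for $\eta$-almost every $z$; and, for every representative of $D^-F$ (written again $D^-_zF(\eta)$), the two integrals below are finite for $\Pi$-almost every $\eta$, and $\Gamma(F)$ is determined uniquely up to $\Pi$-null sets by $$\Gamma(F)(\eta)=\frac12\int(D^+_zF(\eta))^2\,\nu(\mathrm dz)+\frac12\int(D^-_zF(\eta))^2\,\eta(\mathrm dz)\qquad\text{for }\Pi\text{-almost every }\eta.$$ -/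

import Mathlib

open MeasureTheory Filter Topology
open scoped ENNReal

namespace PoissonSpace

noncomputable section

/-- A measure all of whose values on measurable sets are (finite) natural numbers. -/
def IsNatValued {Z : Type*} [MeasurableSpace Z] (μ : Measure Z) : Prop :=
  ∀ B : Set Z, MeasurableSet B → ∃ n : ℕ, μ B = n

/-- The space of all countable sums of `ℕ`-valued measures on `Z`. Its σ-algebra is the trace of
the one on `Measure Z`, which is generated by the evaluations `ξ ↦ ξ B`, `B` measurable. -/
abbrev Config (Z : Type*) [MeasurableSpace Z] : Type _ :=
  {ξ : Measure Z // ∃ μ : ℕ → Measure Z, (∀ i, IsNatValued (μ i)) ∧ ξ = Measure.sum μ}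

variable {Z : Type*} [MeasurableSpace Z]

theorem isNatValued_dirac (z : Z) : IsNatValued (Measure.dirac z) := by
  intro B hB
  by_cases hz : z ∈ B
  · exact ⟨1, by simp [Measure.dirac_apply' z hB, hz]⟩
  · exact ⟨0, by simp [Measure.dirac_apply' z hB, hz]⟩

theorem exists_sum_add_dirac (η : Config Z) (z : Z) :
    ∃ μ : ℕ → Measure Z, (∀ i, IsNatValued (μ i)) ∧
      η.1 + Measure.dirac z = Measure.sum μ := by
  obtain ⟨μ, hμ, hs⟩ := η.2
  refine ⟨fun n => Nat.casesOn n (Measure.dirac z) μ, ?_, ?_⟩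
  · intro i
    cases i with
    | zero => exact isNatValued_dirac z
    | succ k => exact hμ k
  · ext B hB
    rw [Measure.add_apply, hs, Measure.sum_apply _ hB, Measure.sum_apply _ hB, add_comm]
    exact (tsum_eq_zero_add' (f := fun i : ℕ =>
      (Nat.casesOn i (Measure.dirac z) μ : Measure Z) B) ENNReal.summable).symm

/-- `η + δ_z`. -/
def addPoint (η : Config Z) (z : Z) : Config Z :=
  ⟨η.1 + Measure.dirac z, exists_sum_add_dirac η z⟩

/-- `z ∈ η`, that is `δ_z ≤ η`. -/
def HasPoint (η : Config Z) (z : Z) : Prop := Measure.dirac z ≤ η.1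

theorem exists_sum_sub_dirac (η : Config Z) (z : Z) (h : HasPoint η z) :
    ∃ μ : ℕ → Measure Z, (∀ i, IsNatValued (μ i)) ∧
      η.1 - Measure.dirac z = Measure.sum μ := by
  obtain ⟨μ, hμ, hs⟩ := η.2
  have hi : ∃ i, Measure.dirac z ≤ μ i := by
    by_contra! hcon
    have hB : ∀ i, ∃ B, MeasurableSet B ∧ z ∈ B ∧ μ i B = 0 := by
      intro i
      have h1 := hcon i
      rw [Measure.le_iff] at h1
      push Not at h1
      obtain ⟨B, hB, hlt⟩ := h1
      obtain ⟨n, hn⟩ := hμ i B hB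
      have hz : z ∈ B := by
        by_contra hz
        simp [Measure.dirac_apply' z hB, hz] at hlt
      refine ⟨B, hB, hz, ?_⟩
      rw [hn, Measure.dirac_apply' z hB] at hlt
      simp [hz] at hlt
      simp [hn, hlt]
    choose B hBm hBz hB0 using hB
    have hm : MeasurableSet (⋂ i, B i) := MeasurableSet.iInter hBm
    have h2 := Measure.le_iff.1 h _ hm
    have hz : z ∈ ⋂ i, B i := Set.mem_iInter.2 hBz
    have h3 : η.1 (⋂ i, B i) = 0 := by
      rw [hs, Measure.sum_apply _ hm, ENNReal.tsum_eq_zero]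
      exact fun i => measure_mono_null (Set.iInter_subset _ i) (hB0 i)
    rw [h3, Measure.dirac_apply' z hm] at h2
    simp [hz] at h2
  obtain ⟨i, hi⟩ := hi
  refine ⟨Function.update μ i (μ i - Measure.dirac z), ?_, ?_⟩
  · intro j
    by_cases hj : j = i
    · subst hj
      intro B hB
      obtain ⟨n, hn⟩ := hμ j B hB
      obtain ⟨m, hm⟩ := isNatValued_dirac z B hB
      refine ⟨n - m, ?_⟩
      rw [Function.update_self, Measure.sub_apply hB hi, hn, hm]
      simp
    · rw [Function.update_of_ne hj]
      exact hμ j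
  · have key : η.1 = Measure.sum (Function.update μ i (μ i - Measure.dirac z))
        + Measure.dirac z := by
      have h1 : Measure.dirac z = Measure.sum (fun j => if j = i then Measure.dirac z else 0) := by
        ext B hB
        rw [Measure.sum_apply _ hB, tsum_eq_single i]
        · simp
        · intro j hj
          simp [hj]
      have h2 : Measure.sum (Function.update μ i (μ i - Measure.dirac z))
          + Measure.sum (fun j => if j = i then Measure.dirac z else 0) = Measure.sum μ := by
        rw [Measure.sum_add_sum]
        congr 1
        funext j
        by_cases hj : j = i
        · subst hj
          simp [Measure.sub_add_cancel_of_le hi]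
        · simp [hj]
      rw [hs, ← h2, ← h1]
    calc η.1 - Measure.dirac z
        = Measure.sum (Function.update μ i (μ i - Measure.dirac z)) + Measure.dirac z
          - Measure.dirac z := by rw [← key]
      _ = _ := Measure.add_sub_cancel

/-- `η - δ_z`, for `z ∈ η`. -/
def removePoint (η : Config Z) (z : Z) (h : HasPoint η z) : Config Z :=
  ⟨η.1 - Measure.dirac z, exists_sum_sub_dirac η z h⟩

/-- `P` is the law of the Poisson point process with intensity `ν`: it is the probability on
the space of configurations for which the Mecke equation holds. -/
structure IsPoissonProcess (ν : Measure Z) (P : Measure (Config Z)) : Prop where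
  prob : IsProbabilityMeasure P
  mecke : ∀ u : Config Z × Z → ℝ≥0∞, Measurable u →
    ∫⁻ η, ∫⁻ z, u (η, z) ∂η.1 ∂P = ∫⁻ z, ∫⁻ η, u (addPoint η z, z) ∂P ∂ν

/-- The add operator `D⁺_z F(η) = F(η + δ_z) - F(η)`. -/
def addOp (F : Config Z → ℝ) (η : Config Z) (z : Z) : ℝ := F (addPoint η z) - F η

open Classical in
/-- The drop operator `D⁻_z F(η) = (F(η) - F(η - δ_z)) 1_{z ∈ η}`. -/
def dropOp (F : Config Z → ℝ) (η : Config Z) (z : Z) : ℝ :=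
  if h : HasPoint η z then F η - F (removePoint η z h) else 0

/-- `u` is a representative of `D⁻F`: up to a modification on a set that is not charged by
`η(dz) P(dη)`, it is a jointly measurable function which coincides with `D⁻_z F(η)` at all points
`(η, z)` with `z ∈ η`. On a general measurable space the set `{(η, z) | z ∈ η}` may fail to be
measurable, even up to null sets, and `D⁻F`, extended by `0`, need then not be a representative
of itself. -/
def IsDropVersion (P : Measure (Config Z)) (F : Config Z → ℝ) (u : Config Z → Z → ℝ) : Prop :=
  ∃ v : Config Z × Z → ℝ, Measurable v ∧
    (∀ η z, HasPoint η z → v (η, z) = dropOp F η z) ∧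
    ∀ᵐ η ∂P, ∀ᵐ z ∂η.1, u η z = v (η, z)

/-- `F ∈ dom D`. -/
def MemDomD (ν : Measure Z) (P : Measure (Config Z)) (F : Config Z → ℝ) : Prop :=
  Measurable F ∧ MemLp F 2 P ∧
    ∫⁻ z, ∫⁻ η, ENNReal.ofReal ((addOp F η z) ^ 2) ∂P ∂ν < ∞

/-- The Dirichlet form `E(F, G) = (P ⊗ ν)(DF DG)`. -/
def energy (ν : Measure Z) (P : Measure (Config Z)) (F G : Config Z → ℝ) : ℝ :=
  ∫ p, addOp F p.1 p.2 * addOp G p.1 p.2 ∂(P.prod ν)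

/-- The algebra `A = dom D ∩ L^∞(P)`. -/
def MemAlg (ν : Measure Z) (P : Measure (Config Z)) (F : Config Z → ℝ) : Prop :=
  MemDomD ν P F ∧ MemLp F ∞ P

/-- `Γ(F)[Φ] = E(F, F Φ) - 1/2 E(F², Φ)`, for `F` and `Φ` in the algebra. -/
def gammaAlg (ν : Measure Z) (P : Measure (Config Z)) (F Φ : Config Z → ℝ) : ℝ :=
  energy ν P F (fun η => F η * Φ η) - 1 / 2 * energy ν P (fun η => F η ^ 2) Φ

/-- `Fn` is a sequence in the algebra that converges to `F` in the Hilbert space `dom D`, whose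
squared norm is `P(F²) + E(F, F)`. -/
def IsApprox (ν : Measure Z) (P : Measure (Config Z)) (F : Config Z → ℝ)
    (Fn : ℕ → Config Z → ℝ) : Prop :=
  (∀ n, MemAlg ν P (Fn n)) ∧
    Tendsto (fun n => ∫ η, (Fn n η - F η) ^ 2 ∂P
      + energy ν P (fun η => Fn n η - F η) (fun η => Fn n η - F η)) atTop (𝓝 0)

/-- `ℓ` is the value at `Φ` of the continuous extension to `F ∈ dom D` of `F ↦ Γ(F)[Φ]`. -/
def IsGammaAt (ν : Measure Z) (P : Measure (Config Z)) (F Φ : Config Z → ℝ) (ℓ : ℝ) : Prop :=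
  (∃ Fn, IsApprox ν P F Fn) ∧
    ∀ Fn, IsApprox ν P F Fn → Tendsto (fun n => gammaAlg ν P (Fn n) Φ) atTop (𝓝 ℓ)

/-- `γ` is a density of the linear form `Φ ↦ Γ(F)[Φ]` with respect to `P`. -/
def IsCarreDuChamp (ν : Measure Z) (P : Measure (Config Z)) (F γ : Config Z → ℝ) : Prop :=
  0 ≤ᵐ[P] γ ∧ Integrable γ P ∧
    ∀ Φ, MemAlg ν P Φ → IsGammaAt ν P F Φ (∫ η, γ η * Φ η ∂P)

/-- `F ∈ dom Γ`. -/
def MemDomGamma (ν : Measure Z) (P : Measure (Config Z)) (F : Config Z → ℝ) : Prop :=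
  MemDomD ν P F ∧ ∃ γ, IsCarreDuChamp ν P F γ

end

end PoissonSpace

/-!
The proof rests on the form of the Mecke equation in `IsPoissonProcess.compProd_eq_map`: the
Campbell measure `η(dz) P(dη)` is the image of `P ⊗ ν` under `(η, z) ↦ (η + δ_z, z)`. Since the
configurations are s-finite measures only one by one, this first needs a genuine s-finite kernel
that agrees with `η ↦ η` almost surely (`configKernel`); it exists because `E η(B) = ν(B)`.

For `F` and `Φ` in the algebra, expanding the increments gives
`D⁺F · D⁺(FΦ) - D⁺(F²) · D⁺Φ / 2 = (D⁺F)² (Φ(η) + Φ(η + δ_z)) / 2`, so `Γ(F)[Φ]` is the integral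
of the right-hand side against `P ⊗ ν` (`gammaAlg_eq_gammaForm`). This is a quadratic form in
`D⁺F ∈ L²(P ⊗ ν)` with a bounded weight, hence continuous on `dom D` (`tendsto_gammaAlg`), and
truncations of `F` converge to `F` in `dom D` (`isApprox_clip`); so the extension to `dom D` is
given by the same integral (`isGammaAt_iff`). The half with weight `Φ(η)` is the integral of
`Φ · ∫ (D⁺F)² dν / 2`; the half with weight `Φ(η + δ_z)` becomes, by the Mecke equation, the
integral of `Φ · ∫ (D⁻F)² dη / 2`. This is `isCarreDuChamp_of_dropOp`.

On a general measurable space `{(η, z) | z ∈ η}` need not be measurable. A measurable version of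
`D⁻F` exists nevertheless (`exists_measurable_eq_dropOp`): the map `(η, z) ↦ (η + δ_z, z)`
generates the whole product σ-algebra, so `F(η)` is a measurable function of `(η + δ_z, z)`.

The density is unique because the algebra contains the indicators of all events determined by the
configuration in a set of finite intensity. These events form a π-system that generates the
σ-algebra (`ae_eq_of_forall_memAlg`).
-/

open ProbabilityTheory

namespace PoissonSpace

variable {Z : Type*} [MeasurableSpace Z]

/-! ### Adding and removing a point -/

theorem measurable_config_eval {B : Set Z} (hB : MeasurableSet B) :
    Measurable fun η : Config Z => η.1 B :=
  (Measure.measurable_coe hB).comp measurable_subtype_coe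

theorem measurable_config_iff {X : Type*} [MeasurableSpace X] {f : X → Config Z} :
    Measurable f ↔ ∀ B : Set Z, MeasurableSet B → Measurable fun x => (f x).1 B := by
  refine ⟨fun hf B hB => (measurable_config_eval hB).comp hf, fun h => ?_⟩
  exact measurable_comap_iff.2 (Measure.measurable_of_measurable_coe _ h)

theorem addPoint_apply (η : Config Z) (z : Z) {B : Set Z} (hB : MeasurableSet B) :
    (addPoint η z).1 B = η.1 B + B.indicator 1 z := by
  rw [addPoint, Measure.add_apply, Measure.dirac_apply' z hB]

theorem measurable_addPoint : Measurable fun p : Config Z × Z => addPoint p.1 p.2 := by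
  rw [measurable_config_iff]
  intro B hB
  simp_rw [addPoint_apply _ _ hB]
  exact ((measurable_config_eval hB).comp measurable_fst).add
    ((measurable_one.indicator hB).comp measurable_snd)

theorem hasPoint_addPoint (η : Config Z) (z : Z) : HasPoint (addPoint η z) z :=
  Measure.le_add_left le_rfl

theorem removePoint_addPoint (η : Config Z) (z : Z) (h : HasPoint (addPoint η z) z) :
    removePoint (addPoint η z) z h = η :=
  Subtype.ext Measure.add_sub_cancel

theorem addPoint_removePoint (η : Config Z) (z : Z) (h : HasPoint η z) :
    addPoint (removePoint η z h) z = η :=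
  Subtype.ext (Measure.sub_add_cancel_of_le h)

theorem dropOp_addPoint (F : Config Z → ℝ) (η : Config Z) (z : Z) :
    dropOp F (addPoint η z) z = addOp F η z := by
  rw [dropOp, dif_pos (hasPoint_addPoint η z), removePoint_addPoint, addOp]

theorem measurable_addOp {F : Config Z → ℝ} (hF : Measurable F) :
    Measurable fun p : Config Z × Z => addOp F p.1 p.2 :=
  (hF.comp measurable_addPoint).sub (hF.comp measurable_fst)

/-- The map `(η, z) ↦ (η + δ_z, z)`. -/
noncomputable def addMap (p : Config Z × Z) : Config Z × Z := (addPoint p.1 p.2, p.2)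

theorem measurable_addMap : Measurable (addMap (Z := Z)) :=
  measurable_addPoint.prodMk measurable_snd

/-- The configuration `η` is a measurable function of the pair `(η + δ_z, z)`, because
`η B = (η + δ_z) B - 1_B z`. No measurability of `{(η, z) | z ∈ η}` is involved. -/
theorem measurable_fst_comap_addMap :
    Measurable[MeasurableSpace.comap addMap inferInstance]
      (Prod.fst : Config Z × Z → Config Z) := by
  rw [@measurable_config_iff _ _ _ (MeasurableSpace.comap addMap inferInstance)]
  intro B hB
  have hg : Measurable fun q : Config Z × Z => q.1.1 B - B.indicator 1 q.2 :=
    ((measurable_config_eval hB).comp measurable_fst).sub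
      ((measurable_one.indicator hB).comp measurable_snd)
  have heq : (fun x : Config Z × Z => x.1.1 B)
      = (fun q : Config Z × Z => q.1.1 B - B.indicator 1 q.2) ∘ addMap := by
    funext p
    have h1 : (B.indicator 1 p.2 : ℝ≥0∞) ≠ ∞ := by
      by_cases h : p.2 ∈ B <;> simp [h]
    simp only [Function.comp, addMap, addPoint_apply _ _ hB]
    rw [ENNReal.add_sub_cancel_right h1]
  rw [heq]
  exact hg.comp (comap_measurable addMap)

/-- By the Doob–Dynkin factorization through `(η, z) ↦ (η + δ_z, z)`, the drop operator
coincides with a jointly measurable function at all `(η, z)` with `z ∈ η`. -/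
theorem exists_measurable_eq_dropOp {F : Config Z → ℝ} (hF : Measurable F) :
    ∃ v : Config Z × Z → ℝ, Measurable v ∧ ∀ η z, HasPoint η z → v (η, z) = dropOp F η z := by
  obtain ⟨w, hw, hFw⟩ := (hF.comp measurable_fst_comap_addMap).exists_eq_measurable_comp
  refine ⟨fun p => F p.1 - w p, (hF.comp measurable_fst).sub hw, fun η z h => ?_⟩
  have h1 := congrFun hFw (removePoint η z h, z)
  simp only [Function.comp, addMap, addPoint_removePoint] at h1
  rw [dropOp, dif_pos h, h1]

/-! ### The Mecke equation as an identity of measures -/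

section Campbell

variable {ν : Measure Z} {P : Measure (Config Z)}

open Classical in
/-- The points of the configuration in `B`, as long as their number lies in `[k, k + 1)`. The
cut-off by the number of points makes this a finite kernel. -/
noncomputable def truncKernel {B : Set Z} (hB : MeasurableSet B) (k : ℕ) :
    Kernel (Config Z) Z :=
  Kernel.piecewise (s := (fun η => η.1 B) ⁻¹' Set.Ico (k : ℝ≥0∞) (k + 1))
    (measurable_config_eval hB measurableSet_Ico)
    (Kernel.restrict ⟨fun η => η.1, measurable_subtype_coe⟩ hB) 0

open Classical in
theorem truncKernel_apply {B : Set Z} (hB : MeasurableSet B) (k : ℕ) (η : Config Z) :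
    truncKernel hB k η
      = if η.1 B ∈ Set.Ico (k : ℝ≥0∞) (k + 1) then η.1.restrict B else 0 := by
  rw [truncKernel, Kernel.piecewise_apply, Kernel.restrict_apply]
  exact if_congr Iff.rfl rfl rfl

instance {B : Set Z} (hB : MeasurableSet B) (k : ℕ) : IsFiniteKernel (truncKernel hB k) := by
  refine ⟨⟨k + 1, by simp, fun η => ?_⟩⟩
  rw [truncKernel_apply]
  split_ifs with h
  · rw [Measure.restrict_apply_univ]
    exact h.2.le
  · simp

theorem sum_truncKernel_apply {B : Set Z} (hB : MeasurableSet B) (η : Config Z)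
    (h : η.1 B ≠ ∞) : Kernel.sum (truncKernel hB) η = η.1.restrict B := by
  ext A hA
  lift η.1 B to NNReal using h with r hr
  have hk : ∀ k : ℕ, η.1 B ∈ Set.Ico (k : ℝ≥0∞) (k + 1) ↔ k = ⌊r⌋₊ := by
    intro k
    rw [← hr, Set.mem_Ico, eq_comm (a := k), Nat.floor_eq_iff zero_le]
    norm_cast
  rw [Kernel.sum_apply' _ _ hA, tsum_eq_single ⌊r⌋₊]
  · rw [truncKernel_apply, if_pos ((hk _).2 rfl)]
  · intro k hne
    rw [truncKernel_apply, if_neg (fun h => hne ((hk _).1 h))]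
    simp

/-- An s-finite version of the kernel `η ↦ η`. The sets `disjointed (spanningSets ν) n` partition
`Z` and have finite intensity; the points of `η` in those of them that have infinite `η`-mass are
left out, which almost surely concerns none of them. -/
noncomputable def configKernel (ν : Measure Z) [SigmaFinite ν] : Kernel (Config Z) Z :=
  Kernel.sum fun n => Kernel.sum
    (truncKernel (MeasurableSet.disjointed (measurableSet_spanningSets ν) n))

instance [SigmaFinite ν] : IsSFiniteKernel (configKernel ν) :=
  Kernel.isSFiniteKernel_sum

theorem IsPoissonProcess.lintegral_config_apply (hP : IsPoissonProcess ν P) {B : Set Z}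
    (hB : MeasurableSet B) : ∫⁻ η, η.1 B ∂P = ν B := by
  have := hP.prob
  have h := hP.mecke (fun p => B.indicator 1 p.2)
    ((measurable_one.indicator hB).comp measurable_snd)
  simpa [lintegral_indicator_one hB] using h

theorem IsPoissonProcess.configKernel_ae_eq [SigmaFinite ν] (hP : IsPoissonProcess ν P) :
    ∀ᵐ η ∂P, configKernel ν η = η.1 := by
  have hfin : ∀ᵐ η ∂P, ∀ n, η.1 (disjointed (spanningSets ν) n) < ∞ := by
    refine ae_all_iff.2 fun n => ?_
    have hB := MeasurableSet.disjointed (measurableSet_spanningSets ν) n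
    refine ae_lt_top (measurable_config_eval hB) ?_
    rw [hP.lintegral_config_apply hB]
    exact ((measure_mono (disjointed_subset _ n)).trans_lt (measure_spanningSets_lt_top ν n)).ne
  filter_upwards [hfin] with η hη
  rw [configKernel, Kernel.sum_apply]
  simp_rw [fun n => sum_truncKernel_apply (MeasurableSet.disjointed
    (measurableSet_spanningSets ν) n) η (hη n).ne]
  exact sum_restrict_disjointed_spanningSets η.1 ν

/-- The Mecke equation: the Campbell measure `η(dz) P(dη)` is the image of `P ⊗ ν` under
`(η, z) ↦ (η + δ_z, z)`. -/
theorem IsPoissonProcess.compProd_eq_map [SigmaFinite ν] (hP : IsPoissonProcess ν P) :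
    P ⊗ₘ configKernel ν = (P.prod ν).map addMap := by
  have := hP.prob
  refine Measure.ext_of_lintegral _ fun f hf => ?_
  rw [Measure.lintegral_compProd hf, lintegral_map hf measurable_addMap,
    lintegral_prod_symm (fun q => f (addMap q)) (hf.comp measurable_addMap).aemeasurable]
  refine (lintegral_congr_ae ?_).trans (hP.mecke f hf)
  filter_upwards [hP.configKernel_ae_eq] with η hη
  rw [hη]

/-- The law of `η + δ_z` under `P ⊗ ν` is absolutely continuous with respect to `P`. -/
theorem IsPoissonProcess.ae_addPoint [SigmaFinite ν] (hP : IsPoissonProcess ν P)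
    {p : Config Z → Prop} (h : ∀ᵐ η ∂P, p η) :
    ∀ᵐ q ∂P.prod ν, p (addPoint q.1 q.2) := by
  have := hP.prob
  have hN : P (toMeasurable P {η | ¬ p η}) = 0 := by rw [measure_toMeasurable]; exact h
  have h1 : ∀ᵐ q ∂P ⊗ₘ configKernel ν, q.1 ∉ toMeasurable P {η | ¬ p η} :=
    Measure.ae_compProd_of_ae_fst _ (measurableSet_toMeasurable _ _).compl
      (measure_eq_zero_iff_ae_notMem.1 hN)
  rw [hP.compProd_eq_map] at h1
  filter_upwards [ae_of_ae_map measurable_addMap.aemeasurable h1] with q hq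
  by_contra hcon
  exact hq (subset_toMeasurable _ _ hcon)

end Campbell

/-! ### The domain of the add operator and the algebra of bounded functionals -/

section Domain

variable {ν : Measure Z} {P : Measure (Config Z)} {F Φ : Config Z → ℝ}

theorem MemAlg.exists_bound (hF : MemAlg ν P F) : ∃ C, ∀ᵐ η ∂P, |F η| ≤ C := by
  refine ⟨(eLpNorm F ∞ P).toReal, ?_⟩
  filter_upwards [ae_le_eLpNormEssSup (f := F) (μ := P)] with η hη
  rw [← eLpNorm_exponent_top] at hη
  simpa using ENNReal.toReal_mono hF.2.2.ne hη

variable [SigmaFinite ν]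

theorem IsPoissonProcess.memDomD_iff (hP : IsPoissonProcess ν P) :
    MemDomD ν P F ↔ Measurable F ∧ MemLp F 2 P ∧
      MemLp (fun p : Config Z × Z => addOp F p.1 p.2) 2 (P.prod ν) := by
  have := hP.prob
  refine and_congr_right fun hF => and_congr_right fun _ => ?_
  have hD := measurable_addOp hF
  rw [memLp_two_iff_integrable_sq hD.aestronglyMeasurable,
    ← lintegral_ofReal_ne_top_iff_integrable (hD.pow_const 2).aestronglyMeasurable
      (Eventually.of_forall fun _ => sq_nonneg _),
    lintegral_prod_symm _ (hD.pow_const 2).ennreal_ofReal.aemeasurable, lt_top_iff_ne_top]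

theorem MemDomD.memLp_addOp (hP : IsPoissonProcess ν P) (hF : MemDomD ν P F) :
    MemLp (fun p : Config Z × Z => addOp F p.1 p.2) 2 (P.prod ν) :=
  (hP.memDomD_iff.1 hF).2.2

theorem IsPoissonProcess.exists_bound_prod (hP : IsPoissonProcess ν P) (hF : MemAlg ν P F) :
    ∃ C, ∀ᵐ p ∂P.prod ν, |F p.1| ≤ C ∧ |F (addPoint p.1 p.2)| ≤ C := by
  have := hP.prob
  obtain ⟨C, hC⟩ := hF.exists_bound
  exact ⟨C, (Measure.quasiMeasurePreserving_fst.ae hC).and (hP.ae_addPoint hC)⟩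

theorem memLp_addOp_mul (hP : IsPoissonProcess ν P) (hF : MemAlg ν P F) (hΦ : MemAlg ν P Φ) :
    MemLp (fun p : Config Z × Z => addOp (fun η => F η * Φ η) p.1 p.2) 2 (P.prod ν) := by
  have := hP.prob
  obtain ⟨C, hC⟩ := hP.exists_bound_prod hF
  obtain ⟨K, hK⟩ := hP.exists_bound_prod hΦ
  have h1 : MemLp (fun p : Config Z × Z => F (addPoint p.1 p.2) * addOp Φ p.1 p.2) 2
      (P.prod ν) := by
    refine (hΦ.1.memLp_addOp hP).of_le_mul (c := C)
      ((hF.1.1.comp measurable_addPoint).mul (measurable_addOp hΦ.1.1)).aestronglyMeasurable ?_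
    filter_upwards [hC] with p hp
    rw [norm_mul]
    exact mul_le_mul_of_nonneg_right hp.2 (norm_nonneg _)
  have h2 : MemLp (fun p : Config Z × Z => Φ p.1 * addOp F p.1 p.2) 2 (P.prod ν) := by
    refine (hF.1.memLp_addOp hP).of_le_mul (c := K)
      ((hΦ.1.1.comp measurable_fst).mul (measurable_addOp hF.1.1)).aestronglyMeasurable ?_
    filter_upwards [hK] with p hp
    rw [norm_mul]
    exact mul_le_mul_of_nonneg_right hp.1 (norm_nonneg _)
  refine (h1.add h2).ae_eq (Eventually.of_forall fun p => ?_)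
  simp only [addOp, Pi.add_apply]
  ring

/-! ### The quadratic form `F ↦ Γ(F)[Φ]` -/

/-- The integral of `(D⁺F)² (Φ(η) + Φ(η + δ_z)) / 2` against `P ⊗ ν`, which is the extension of
`F ↦ Γ(F)[Φ]` to `dom D` in closed form. -/
noncomputable def gammaForm (ν : Measure Z) (P : Measure (Config Z)) (F Φ : Config Z → ℝ) : ℝ :=
  ∫ p, addOp F p.1 p.2 ^ 2 * (1 / 2 * (Φ p.1 + Φ (addPoint p.1 p.2))) ∂P.prod ν

/-- With `a = F η`, `b = F (η + δ_z)`, `p = Φ η`, `q = Φ (η + δ_z)`, this is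
`(b - a) (b q - a p) - (b² - a²) (q - p) / 2 = (b - a)² (p + q) / 2`. -/
theorem gammaAlg_eq_gammaForm (hP : IsPoissonProcess ν P) (hF : MemAlg ν P F)
    (hΦ : MemAlg ν P Φ) : gammaAlg ν P F Φ = gammaForm ν P F Φ := by
  have h1 : Integrable (fun p : Config Z × Z =>
      addOp F p.1 p.2 * addOp (fun η => F η * Φ η) p.1 p.2) (P.prod ν) :=
    (hF.1.memLp_addOp hP).integrable_mul (memLp_addOp_mul hP hF hΦ)
  have h2 := (memLp_addOp_mul hP hF hF).integrable_mul (hΦ.1.memLp_addOp hP)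
  have h2' : Integrable (fun p : Config Z × Z =>
      addOp (fun η => F η ^ 2) p.1 p.2 * addOp Φ p.1 p.2) (P.prod ν) := by
    simpa only [Pi.mul_def, pow_two] using h2
  rw [gammaAlg, energy, energy, ← integral_const_mul, ← integral_sub h1 (h2'.const_mul _)]
  refine integral_congr_ae (Eventually.of_forall fun p => ?_)
  simp only [addOp]
  ring

theorem abs_weight_le (hP : IsPoissonProcess ν P) (hΦ : MemAlg ν P Φ) :
    ∃ C, ∀ᵐ p ∂P.prod ν, |1 / 2 * (Φ p.1 + Φ (addPoint p.1 p.2))| ≤ C := by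
  obtain ⟨C, hC⟩ := hP.exists_bound_prod hΦ
  refine ⟨C, ?_⟩
  filter_upwards [hC] with p hp
  have h1 := abs_le.1 hp.1
  have h2 := abs_le.1 hp.2
  exact abs_le.2 ⟨by linarith, by linarith⟩

theorem measurable_weight (hΦ : Measurable Φ) : Measurable fun p : Config Z × Z =>
    1 / 2 * (Φ p.1 + Φ (addPoint p.1 p.2)) :=
  ((hΦ.comp measurable_fst).add (hΦ.comp measurable_addPoint)).const_mul _

/-- Continuity of a bounded-weight quadratic form with respect to `L²` convergence. -/
theorem tendsto_integral_sq_mul {X : Type*} [MeasurableSpace X] {μ : Measure X} {f w : X → ℝ}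
    {g : ℕ → X → ℝ} (hf : MemLp f 2 μ) (hg : ∀ n, MemLp (g n) 2 μ)
    (hw : AEStronglyMeasurable w μ) {C : ℝ} (hC : ∀ᵐ x ∂μ, |w x| ≤ C)
    (h : Tendsto (fun n => ∫ x, (g n x - f x) ^ 2 ∂μ) atTop (𝓝 0)) :
    Tendsto (fun n => ∫ x, g n x ^ 2 * w x ∂μ) atTop (𝓝 (∫ x, f x ^ 2 * w x ∂μ)) := by
  have hd : ∀ n, MemLp (fun x => |g n x - f x|) 2 μ := fun n => ((hg n).sub hf).abs
  have hfa : MemLp (fun x => |f x|) 2 μ := hf.abs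
  have hint : ∀ {k : X → ℝ}, MemLp k 2 μ → Integrable (fun x => k x ^ 2 * w x) μ :=
    fun hk => hk.integrable_sq.mul_bdd hw hC
  have hholder : ∀ n, ∫ x, |f x| * |g n x - f x| ∂μ
      ≤ (∫ x, f x ^ 2 ∂μ) ^ (1 / 2 : ℝ) * (∫ x, (g n x - f x) ^ 2 ∂μ) ^ (1 / 2 : ℝ) := by
    intro n
    have := integral_mul_le_Lp_mul_Lq_of_nonneg (μ := μ) (p := 2) (q := 2)
      (Real.HolderConjugate.two_two) (Eventually.of_forall fun x => abs_nonneg (f x))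
      (Eventually.of_forall fun x => abs_nonneg (g n x - f x))
      (by simpa using hfa) (by simpa using hd n)
    simpa using this
  refine tendsto_iff_norm_sub_tendsto_zero.2 ?_
  have hlim : Tendsto (fun n => |C| * (∫ x, (g n x - f x) ^ 2 ∂μ
      + 2 * ((∫ x, f x ^ 2 ∂μ) ^ (1 / 2 : ℝ)
        * (∫ x, (g n x - f x) ^ 2 ∂μ) ^ (1 / 2 : ℝ)))) atTop (𝓝 0) := by
    have h2 := (h.rpow_const (p := 1 / 2) (Or.inr (by norm_num)))
    rw [Real.zero_rpow (by norm_num)] at h2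
    simpa using ((h.add ((h2.const_mul _).const_mul 2)).const_mul |C|)
  refine squeeze_zero (fun _ => norm_nonneg _) (fun n => ?_) hlim
  have hi1 : Integrable (fun x => (g n x - f x) ^ 2) μ := ((hg n).sub hf).integrable_sq
  have hi2 : Integrable (fun x => |f x| * |g n x - f x|) μ := hfa.integrable_mul (hd n)
  calc ‖∫ x, g n x ^ 2 * w x ∂μ - ∫ x, f x ^ 2 * w x ∂μ‖
      = ‖∫ x, (g n x ^ 2 * w x - f x ^ 2 * w x) ∂μ‖ := by
        rw [integral_sub (hint (hg n)) (hint hf)]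
    _ ≤ ∫ x, |C| * ((g n x - f x) ^ 2 + 2 * (|f x| * |g n x - f x|)) ∂μ := by
        refine norm_integral_le_of_norm_le ((hi1.add (hi2.const_mul 2)).const_mul _) ?_
        filter_upwards [hC] with x hx
        have e : g n x ^ 2 * w x - f x ^ 2 * w x
            = w x * ((g n x - f x) ^ 2 + 2 * (f x * (g n x - f x))) := by ring
        rw [e, norm_mul]
        refine mul_le_mul (hx.trans (le_abs_self C)) ?_ (norm_nonneg _) (abs_nonneg _)
        refine (norm_add_le _ _).trans (add_le_add ?_ ?_)
        · simp
        · simp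
    _ = |C| * (∫ x, (g n x - f x) ^ 2 ∂μ + 2 * ∫ x, |f x| * |g n x - f x| ∂μ) := by
        rw [integral_const_mul, integral_add hi1 (hi2.const_mul 2), integral_const_mul]
    _ ≤ _ := by
        have := hholder n
        gcongr

theorem tendsto_gammaAlg (hP : IsPoissonProcess ν P) (hF : MemDomD ν P F)
    (hΦ : MemAlg ν P Φ) {Fn : ℕ → Config Z → ℝ} (h : IsApprox ν P F Fn) :
    Tendsto (fun n => gammaAlg ν P (Fn n) Φ) atTop (𝓝 (gammaForm ν P F Φ)) := by
  simp_rw [fun n => gammaAlg_eq_gammaForm hP (h.1 n) hΦ]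
  obtain ⟨C, hC⟩ := abs_weight_le hP hΦ
  refine tendsto_integral_sq_mul (hF.memLp_addOp hP) (fun n => (h.1 n).1.memLp_addOp hP)
    (measurable_weight hΦ.1.1).aestronglyMeasurable hC ?_
  refine squeeze_zero (fun n => integral_nonneg fun p => sq_nonneg _) (fun n => ?_) h.2
  have e : energy ν P (fun η => Fn n η - F η) (fun η => Fn n η - F η)
      = ∫ p : Config Z × Z, (addOp (Fn n) p.1 p.2 - addOp F p.1 p.2) ^ 2 ∂P.prod ν := by
    refine integral_congr_ae (Eventually.of_forall fun p => ?_)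
    simp only [addOp]
    ring
  rw [e]
  exact le_add_of_nonneg_left (integral_nonneg fun η => sq_nonneg _)

/-! ### Approximation by truncation -/

/-- Truncation of a real number to `[-n, n]`. -/
noncomputable def clip (n : ℕ) (x : ℝ) : ℝ := max (min n x) (-n)

theorem measurable_clip (n : ℕ) : Measurable (clip n) := by
  unfold clip
  fun_prop

theorem abs_clip_sub_le (n : ℕ) (x y : ℝ) : |clip n x - clip n y| ≤ |x - y| := by
  unfold clip
  exact (abs_max_sub_max_le_abs _ _ _).trans
    (by simpa using abs_min_sub_min_le_max (n : ℝ) x n y)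

theorem abs_clip_le (n : ℕ) (x : ℝ) : |clip n x| ≤ n := by
  have : (0 : ℝ) ≤ n := n.cast_nonneg
  exact abs_le.2 ⟨le_max_right _ _, max_le (min_le_left _ _) (by linarith)⟩

theorem abs_clip_le_abs (n : ℕ) (x : ℝ) : |clip n x| ≤ |x| := by
  simpa [clip] using abs_clip_sub_le n x 0

theorem clip_eq_self {n : ℕ} {x : ℝ} (h : |x| ≤ n) : clip n x = x := by
  have := abs_le.1 h
  rw [clip, min_eq_right this.2, max_eq_left this.1]

theorem eventually_clip_eq (x : ℝ) : ∀ᶠ n in atTop, clip n x = x := by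
  obtain ⟨N, hN⟩ := exists_nat_ge |x|
  filter_upwards [eventually_ge_atTop N] with n hn
  exact clip_eq_self (hN.trans (by exact_mod_cast hn))

theorem memAlg_clip (hP : IsPoissonProcess ν P) (hF : MemDomD ν P F) (n : ℕ) :
    MemAlg ν P fun η => clip n (F η) := by
  have := hP.prob
  have hm : Measurable fun η => clip n (F η) := (measurable_clip n).comp hF.1
  refine ⟨hP.memDomD_iff.2 ⟨hm, hF.2.1.mono hm.aestronglyMeasurable
    (Eventually.of_forall fun η => abs_clip_le_abs n (F η)), (hF.memLp_addOp hP).mono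
    (measurable_addOp hm).aestronglyMeasurable
    (Eventually.of_forall fun p => abs_clip_sub_le n _ _)⟩, ?_⟩
  exact memLp_top_of_bound hm.aestronglyMeasurable n
    (Eventually.of_forall fun η => abs_clip_le n (F η))

theorem isApprox_clip (hP : IsPoissonProcess ν P) (hF : MemDomD ν P F) :
    IsApprox ν P F fun n η => clip n (F η) := by
  have := hP.prob
  refine ⟨memAlg_clip hP hF, ?_⟩
  have hD := hF.memLp_addOp hP
  have h1 : Tendsto (fun n => ∫ η, (clip n (F η) - F η) ^ 2 ∂P) atTop (𝓝 (∫ _, 0 ∂P)) := by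
    refine tendsto_integral_of_dominated_convergence (fun η => 4 * F η ^ 2)
      (fun n => ((((measurable_clip n).comp hF.1).sub hF.1).pow_const 2).aestronglyMeasurable)
      (hF.2.1.integrable_sq.const_mul 4) (fun n => Eventually.of_forall fun η => ?_)
      (Eventually.of_forall fun η => ?_)
    · have h := abs_clip_le_abs n (F η)
      have h' : |clip n (F η) - F η| ≤ |2 * F η| := by
        rw [abs_mul, abs_two]
        linarith [abs_sub (clip n (F η)) (F η)]
      rw [Real.norm_eq_abs, abs_of_nonneg (sq_nonneg _)]
      nlinarith [sq_le_sq.2 h']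
    · refine tendsto_const_nhds.congr' ?_
      filter_upwards [eventually_clip_eq (F η)] with n hn
      simp [hn]
  have h2 : Tendsto (fun n => energy ν P (fun η => clip n (F η) - F η)
      (fun η => clip n (F η) - F η)) atTop (𝓝 (∫ _, 0 ∂P.prod ν)) := by
    have hm : ∀ n, Measurable fun p : Config Z × Z =>
        addOp (fun η => clip n (F η) - F η) p.1 p.2 := fun n =>
      measurable_addOp (((measurable_clip n).comp hF.1).sub hF.1)
    refine tendsto_integral_of_dominated_convergence (fun p => 4 * addOp F p.1 p.2 ^ 2)
      (fun n => ((hm n).mul (hm n)).aestronglyMeasurable)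
      (hD.integrable_sq.const_mul 4) (fun n => Eventually.of_forall fun p => ?_)
      (Eventually.of_forall fun p => ?_)
    · have h : |clip n (F (addPoint p.1 p.2)) - clip n (F p.1)| ≤ |addOp F p.1 p.2| :=
        abs_clip_sub_le n _ _
      have e : addOp (fun η => clip n (F η) - F η) p.1 p.2
          = clip n (F (addPoint p.1 p.2)) - clip n (F p.1) - addOp F p.1 p.2 := by
        simp only [addOp]
        ring
      have h' : |addOp (fun η => clip n (F η) - F η) p.1 p.2| ≤ |2 * addOp F p.1 p.2| := by
        rw [abs_mul, abs_two, e]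
        linarith [abs_sub (clip n (F (addPoint p.1 p.2)) - clip n (F p.1)) (addOp F p.1 p.2)]
      rw [Real.norm_eq_abs, ← pow_two, abs_of_nonneg (sq_nonneg _)]
      nlinarith [sq_le_sq.2 h']
    · refine tendsto_const_nhds.congr' ?_
      filter_upwards [eventually_clip_eq (F p.1), eventually_clip_eq (F (addPoint p.1 p.2))]
        with n hn hn'
      simp [addOp, hn, hn']
  simpa using h1.add h2

/-- The continuous extension of `F ↦ Γ(F)[Φ]` to `dom D` exists and is `gammaForm`. -/
theorem isGammaAt_iff (hP : IsPoissonProcess ν P) (hF : MemDomD ν P F) (hΦ : MemAlg ν P Φ)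
    {l : ℝ} : IsGammaAt ν P F Φ l ↔ l = gammaForm ν P F Φ := by
  constructor
  · intro h
    exact tendsto_nhds_unique (h.2 _ (isApprox_clip hP hF))
      (tendsto_gammaAlg hP hF hΦ (isApprox_clip hP hF))
  · rintro rfl
    exact ⟨⟨_, isApprox_clip hP hF⟩, fun _ h => tendsto_gammaAlg hP hF hΦ h⟩

end Domain

/-! ### Local events separate integrable functions -/

theorem measurable_measure_restrict {S : Set Z} (hS : MeasurableSet S) :
    Measurable fun μ : Measure Z => μ.restrict S := by
  refine Measure.measurable_of_measurable_coe _ fun B hB => ?_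
  simp_rw [Measure.restrict_apply hB]
  exact Measure.measurable_coe (hB.inter hS)

section Density

variable {ν : Measure Z} [SigmaFinite ν] {P : Measure (Config Z)} {F Φ : Config Z → ℝ}

/-- The events that only depend on the configuration in one of the sets `spanningSets ν n`. -/
def localEvents (ν : Measure Z) [SigmaFinite ν] : Set (Set (Config Z)) :=
  {s | ∃ n, ∃ t : Set (Measure Z), MeasurableSet t ∧
    s = (fun η : Config Z => η.1.restrict (spanningSets ν n)) ⁻¹' t}

theorem measurable_restrict_config {S : Set Z} (hS : MeasurableSet S) :
    Measurable fun η : Config Z => η.1.restrict S :=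
  (measurable_measure_restrict hS).comp measurable_subtype_coe

theorem measurableSet_of_mem_localEvents {s : Set (Config Z)} (hs : s ∈ localEvents ν) :
    MeasurableSet s := by
  obtain ⟨n, t, ht, rfl⟩ := hs
  exact measurable_restrict_config (measurableSet_spanningSets ν n) ht

theorem isPiSystem_localEvents : IsPiSystem (localEvents ν) := by
  -- An event determined by a smaller set of the sequence is determined by any larger one.
  have mono : ∀ n m, n ≤ m → ∀ t : Set (Measure Z), MeasurableSet t →
      ∃ t' : Set (Measure Z), MeasurableSet t' ∧
        (fun η : Config Z => η.1.restrict (spanningSets ν n)) ⁻¹' t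
          = (fun η : Config Z => η.1.restrict (spanningSets ν m)) ⁻¹' t' := by
    intro n m hnm t ht
    have hn := measurableSet_spanningSets ν n
    refine ⟨(fun μ => μ.restrict (spanningSets ν n)) ⁻¹' t, measurable_measure_restrict hn ht, ?_⟩
    ext η
    simp only [Set.mem_preimage]
    rw [Measure.restrict_restrict hn,
      Set.inter_eq_left.2 (monotone_spanningSets ν hnm)]
  rintro _ ⟨n, t, ht, rfl⟩ _ ⟨m, r, hr, rfl⟩ -
  obtain ⟨t', ht', e1⟩ := mono n (max n m) (le_max_left _ _) t ht
  obtain ⟨r', hr', e2⟩ := mono m (max n m) (le_max_right _ _) r hr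
  exact ⟨max n m, t' ∩ r', ht'.inter hr', by rw [e1, e2, Set.preimage_inter]⟩

theorem generateFrom_localEvents (ν : Measure Z) [SigmaFinite ν] :
    (inferInstance : MeasurableSpace (Config Z)) = MeasurableSpace.generateFrom (localEvents ν) := by
  refine le_antisymm ?_
    (MeasurableSpace.generateFrom_le fun s hs => measurableSet_of_mem_localEvents hs)
  suffices h : Measurable[MeasurableSpace.generateFrom (localEvents ν)]
      (Subtype.val : Config Z → Measure Z) from h.comap_le
  refine @Measure.measurable_of_measurable_coe _ _ _
    (MeasurableSpace.generateFrom (localEvents ν)) _ fun B hB => ?_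
  have e : (fun η : Config Z => η.1 B) = fun η => ⨆ n, η.1.restrict (spanningSets ν n) B := by
    funext η
    simp_rw [Measure.restrict_apply hB]
    rw [← Monotone.measure_iUnion, ← Set.inter_iUnion, iUnion_spanningSets, Set.inter_univ]
    exact fun n m h => Set.inter_subset_inter_right _ (monotone_spanningSets ν h)
  rw [e]
  refine @Measurable.iSup _ _ _ _ _ (MeasurableSpace.generateFrom (localEvents ν)) _ _ _ _ _ _
    fun n => ?_
  intro t ht
  exact MeasurableSpace.measurableSet_generateFrom
    ⟨n, _, Measure.measurable_coe hB ht, rfl⟩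

/-- `D⁺_z` of the indicator of an event that is determined by the configuration in `S` vanishes
for `z ∉ S`. -/
theorem memAlg_indicator (hP : IsPoissonProcess ν P) {S : Set Z} (hS : MeasurableSet S)
    (hνS : ν S < ∞) {t : Set (Measure Z)} (ht : MeasurableSet t) :
    MemAlg ν P (((fun η : Config Z => η.1.restrict S) ⁻¹' t).indicator 1) := by
  have := hP.prob
  set s := (fun η : Config Z => η.1.restrict S) ⁻¹' t with hs
  have hsm : MeasurableSet s := measurable_restrict_config hS ht
  have hm : Measurable (s.indicator (1 : Config Z → ℝ)) := measurable_one.indicator hsm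
  have h01 : ∀ η, 0 ≤ s.indicator (1 : Config Z → ℝ) η ∧ s.indicator (1 : Config Z → ℝ) η ≤ 1 := by
    intro η
    by_cases h : η ∈ s <;> simp [h]
  have hbd : ∀ η, ‖s.indicator (1 : Config Z → ℝ) η‖ ≤ 1 := fun η => by
    rw [Real.norm_eq_abs, abs_of_nonneg (h01 η).1]
    exact (h01 η).2
  have htop : MemLp (s.indicator (1 : Config Z → ℝ)) ∞ P :=
    memLp_top_of_bound hm.aestronglyMeasurable 1 (Eventually.of_forall hbd)
  refine ⟨hP.memDomD_iff.2 ⟨hm, htop.mono_exponent le_top, ?_⟩, htop⟩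
  have hfin : (P.prod ν) (Set.univ ×ˢ S) ≠ ∞ := by
    rw [Measure.prod_prod, measure_univ, one_mul]
    exact hνS.ne
  refine (memLp_indicator_const 2 (MeasurableSet.univ.prod hS) (1 : ℝ) (Or.inr hfin)).mono
    (measurable_addOp hm).aestronglyMeasurable (Eventually.of_forall fun p => ?_)
  by_cases hp : p.2 ∈ S
  · rw [Set.indicator_of_mem (show p ∈ Set.univ ×ˢ S from ⟨trivial, hp⟩), norm_one,
      Real.norm_eq_abs, addOp, abs_le]
    have h1 := h01 p.1
    have h2 := h01 (addPoint p.1 p.2)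
    exact ⟨by linarith, by linarith⟩
  · have hmem : addPoint p.1 p.2 ∈ s ↔ p.1 ∈ s := by
      classical
      simp only [hs, Set.mem_preimage, addPoint, Measure.restrict_add,
        restrict_dirac' hS, if_neg hp, add_zero]
    have h0 : addOp (s.indicator (1 : Config Z → ℝ)) p.1 p.2 = 0 := by
      by_cases h : p.1 ∈ s
      · simp [addOp, h, hmem.2 h]
      · simp [addOp, h, mt hmem.1 h]
    rw [h0]
    simp

/-- The algebra separates `L¹(P)`: it contains the indicators of a generating π-system. -/
theorem ae_eq_of_forall_memAlg (hP : IsPoissonProcess ν P) {f g : Config Z → ℝ}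
    (hf : Integrable f P) (hg : Integrable g P)
    (h : ∀ Φ, MemAlg ν P Φ → ∫ η, f η * Φ η ∂P = ∫ η, g η * Φ η ∂P) : f =ᵐ[P] g := by
  have := hP.prob
  have hset : ∀ {S : Set Z}, MeasurableSet S → ν S < ∞ → ∀ {t : Set (Measure Z)},
      MeasurableSet t →
      ∫ η in (fun η : Config Z => η.1.restrict S) ⁻¹' t, f η ∂P
        = ∫ η in (fun η : Config Z => η.1.restrict S) ⁻¹' t, g η ∂P := by
    intro S hS hνS t ht
    have h1 := h _ (memAlg_indicator hP hS hνS ht)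
    have e : ∀ k : Config Z → ℝ, ∀ s : Set (Config Z),
        (fun η => k η * s.indicator 1 η) = s.indicator k := fun k s => by
      funext η
      by_cases hη : η ∈ s <;> simp [hη]
    have hm := measurable_restrict_config hS ht
    simpa only [e, integral_indicator hm] using h1
  -- The configuration in the empty set determines the sure event.
  have huniv : ∫ η, f η ∂P = ∫ η, g η ∂P := by
    simpa using hset MeasurableSet.empty (by simp) MeasurableSet.univ
  refine hf.ae_eq_of_forall_setIntegral_eq f g hg fun s hs hfin => ?_
  clear hfin
  induction s, hs using MeasurableSpace.induction_on_inter (generateFrom_localEvents ν)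
    isPiSystem_localEvents with
  | empty => simp
  | basic s hs =>
    obtain ⟨n, t, ht, rfl⟩ := hs
    exact hset (measurableSet_spanningSets ν n) (measure_spanningSets_lt_top ν n) ht
  | compl s hs ih =>
    rw [setIntegral_compl hs hf, setIntegral_compl hs hg, huniv, ih]
  | iUnion s hd hs ih =>
    rw [integral_iUnion hs hd hf.integrableOn, integral_iUnion hs hd hg.integrableOn]
    exact tsum_congr ih

/-! ### The density of `Φ ↦ Γ(F)[Φ]` -/

section Version

variable {v : Config Z × Z → ℝ}

/-- By the Mecke equation, integrating `(D⁻F)² Φ` against the Campbell measure amounts to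
integrating `(D⁺_z F(η))² Φ(η + δ_z)` against `P ⊗ ν`. -/
theorem integrable_and_integral_dropOp_sq_mul (hP : IsPoissonProcess ν P) (hF : MemDomD ν P F)
    (hv : Measurable v) (hvF : ∀ η z, HasPoint η z → v (η, z) = dropOp F η z)
    (hΦ : Measurable Φ) {C : ℝ} (hC : ∀ᵐ η ∂P, |Φ η| ≤ C) :
    (∀ᵐ η ∂P, Integrable (fun z => v (η, z) ^ 2 * Φ η) η.1) ∧
    Integrable (fun η => (∫ z, v (η, z) ^ 2 ∂η.1) * Φ η) P ∧
    ∫ η, (∫ z, v (η, z) ^ 2 ∂η.1) * Φ η ∂P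
      = ∫ p : Config Z × Z, addOp F p.1 p.2 ^ 2 * Φ (addPoint p.1 p.2) ∂P.prod ν := by
  have := hP.prob
  have hw : Measurable fun q : Config Z × Z => v q ^ 2 * Φ q.1 :=
    (hv.pow_const 2).mul (hΦ.comp measurable_fst)
  have e : (fun q : Config Z × Z => v q ^ 2 * Φ q.1) ∘ addMap
      = fun p => addOp F p.1 p.2 ^ 2 * Φ (addPoint p.1 p.2) := by
    funext p
    simp only [Function.comp, addMap]
    rw [hvF _ _ (hasPoint_addPoint p.1 p.2), dropOp_addPoint]
  have hi : Integrable (fun q : Config Z × Z => v q ^ 2 * Φ q.1) (P ⊗ₘ configKernel ν) := by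
    rw [hP.compProd_eq_map,
      integrable_map_measure hw.aestronglyMeasurable measurable_addMap.aemeasurable, e]
    exact (hF.memLp_addOp hP).integrable_sq.mul_bdd
      (hΦ.comp measurable_addPoint).aestronglyMeasurable (hP.ae_addPoint hC)
  have hint : Integrable (fun η => ∫ z, v (η, z) ^ 2 * Φ η ∂configKernel ν η) P := by
    have h := hi
    rw [Measure.compProd] at h
    simpa using h.integral_compProd
  have hae : (fun η => ∫ z, v (η, z) ^ 2 * Φ η ∂configKernel ν η)
      =ᵐ[P] fun η => (∫ z, v (η, z) ^ 2 ∂η.1) * Φ η := by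
    filter_upwards [hP.configKernel_ae_eq] with η hη
    rw [hη, integral_mul_const]
  refine ⟨?_, hint.congr hae, ?_⟩
  · filter_upwards [hP.configKernel_ae_eq,
      ((Measure.integrable_compProd_iff hw.aestronglyMeasurable).1 hi).1] with η hη h
    rwa [hη] at h
  · rw [← integral_congr_ae hae, ← Measure.integral_compProd hi, hP.compProd_eq_map,
      integral_map measurable_addMap.aemeasurable hw.aestronglyMeasurable]
    exact congrArg (fun k => ∫ p, k p ∂P.prod ν) e

theorem integrable_and_integral_addOp_sq_mul (hP : IsPoissonProcess ν P) (hF : MemDomD ν P F)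
    (hΦ : Measurable Φ) {C : ℝ} (hC : ∀ᵐ η ∂P, |Φ η| ≤ C) :
    Integrable (fun η => (∫ z, addOp F η z ^ 2 ∂ν) * Φ η) P ∧
    ∫ η, (∫ z, addOp F η z ^ 2 ∂ν) * Φ η ∂P
      = ∫ p : Config Z × Z, addOp F p.1 p.2 ^ 2 * Φ p.1 ∂P.prod ν := by
  have := hP.prob
  have hi : Integrable (fun p : Config Z × Z => addOp F p.1 p.2 ^ 2 * Φ p.1) (P.prod ν) :=
    (hF.memLp_addOp hP).integrable_sq.mul_bdd (hΦ.comp measurable_fst).aestronglyMeasurable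
      (Measure.quasiMeasurePreserving_fst.ae hC)
  simp_rw [← integral_mul_const]
  exact ⟨hi.integral_prod_left, (integral_prod _ hi).symm⟩

theorem isCarreDuChamp_of_dropOp (hP : IsPoissonProcess ν P) (hF : MemDomD ν P F)
    (hv : Measurable v) (hvF : ∀ η z, HasPoint η z → v (η, z) = dropOp F η z) :
    IsCarreDuChamp ν P F fun η =>
      1 / 2 * ∫ z, addOp F η z ^ 2 ∂ν + 1 / 2 * ∫ z, v (η, z) ^ 2 ∂η.1 := by
  have := hP.prob
  have hone : ∀ᵐ η ∂P, |(fun _ => 1 : Config Z → ℝ) η| ≤ 1 := by simp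
  have h1 := (integrable_and_integral_addOp_sq_mul hP hF measurable_const hone).1
  have h2 := (integrable_and_integral_dropOp_sq_mul hP hF hv hvF measurable_const hone).2.1
  simp only [mul_one] at h1 h2
  refine ⟨Eventually.of_forall fun η => ?_, (h1.const_mul _).add (h2.const_mul _),
    fun Φ hΦ => (isGammaAt_iff hP hF hΦ).2 ?_⟩
  · exact add_nonneg
      (mul_nonneg (by norm_num) (integral_nonneg fun _ => sq_nonneg _))
      (mul_nonneg (by norm_num) (integral_nonneg fun _ => sq_nonneg _))
  · obtain ⟨C, hC⟩ := hΦ.exists_bound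
    obtain ⟨hi1, e1⟩ := integrable_and_integral_addOp_sq_mul hP hF hΦ.1.1 hC
    obtain ⟨-, hi2, e2⟩ := integrable_and_integral_dropOp_sq_mul hP hF hv hvF hΦ.1.1 hC
    have hj1 : Integrable (fun p : Config Z × Z => addOp F p.1 p.2 ^ 2 * Φ p.1) (P.prod ν) :=
      (hF.memLp_addOp hP).integrable_sq.mul_bdd
        (hΦ.1.1.comp measurable_fst).aestronglyMeasurable
        (Measure.quasiMeasurePreserving_fst.ae hC)
    have hj2 : Integrable (fun p : Config Z × Z =>
        addOp F p.1 p.2 ^ 2 * Φ (addPoint p.1 p.2)) (P.prod ν) :=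
      (hF.memLp_addOp hP).integrable_sq.mul_bdd
        (hΦ.1.1.comp measurable_addPoint).aestronglyMeasurable (hP.ae_addPoint hC)
    calc ∫ η, (1 / 2 * ∫ z, addOp F η z ^ 2 ∂ν + 1 / 2 * ∫ z, v (η, z) ^ 2 ∂η.1) * Φ η ∂P
        = ∫ η, (1 / 2 * ((∫ z, addOp F η z ^ 2 ∂ν) * Φ η)
            + 1 / 2 * ((∫ z, v (η, z) ^ 2 ∂η.1) * Φ η)) ∂P := by
          refine integral_congr_ae (Eventually.of_forall fun η => ?_)
          ring
      _ = ∫ p : Config Z × Z, (1 / 2 * (addOp F p.1 p.2 ^ 2 * Φ p.1)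
            + 1 / 2 * (addOp F p.1 p.2 ^ 2 * Φ (addPoint p.1 p.2))) ∂P.prod ν := by
          rw [integral_add (hi1.const_mul _) (hi2.const_mul _), integral_const_mul,
            integral_const_mul, e1, e2, integral_add (hj1.const_mul _) (hj2.const_mul _),
            integral_const_mul, integral_const_mul]
      _ = gammaForm ν P F Φ := by
          refine integral_congr_ae (Eventually.of_forall fun p => ?_)
          ring

end Version

theorem IsCarreDuChamp.ae_eq (hP : IsPoissonProcess ν P) (hF : MemDomD ν P F)
    {γ γ' : Config Z → ℝ} (h : IsCarreDuChamp ν P F γ) (h' : IsCarreDuChamp ν P F γ') :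
    γ =ᵐ[P] γ' :=
  ae_eq_of_forall_memAlg hP h.2.1 h'.2.1 fun Φ hΦ =>
    ((isGammaAt_iff hP hF hΦ).1 (h.2.2 Φ hΦ)).trans
      ((isGammaAt_iff hP hF hΦ).1 (h'.2.2 Φ hΦ)).symm

end Density

theorem IsCarreDuChamp.congr {ν : Measure Z} {P : Measure (Config Z)}
    {F γ γ' : Config Z → ℝ} (h : IsCarreDuChamp ν P F γ)
    (e : γ' =ᵐ[P] γ) : IsCarreDuChamp ν P F γ' := by
  refine ⟨h.1.trans e.symm.le, h.2.1.congr e.symm, fun Φ hΦ => ?_⟩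
  rw [integral_congr_ae (e.mono fun η hη => by rw [hη])]
  exact h.2.2 Φ hΦ

end PoissonSpace

/-! ### The representation of the carré du champ -/

theorem mainTheorem1 {Z : Type*} [MeasurableSpace Z] (ν : Measure Z) [SigmaFinite ν]
    (P : Measure (PoissonSpace.Config Z)) (hP : PoissonSpace.IsPoissonProcess ν P) :
    {F | PoissonSpace.MemDomGamma ν P F} = {F | PoissonSpace.MemDomD ν P F} ∧
    ∀ F : PoissonSpace.Config Z → ℝ, PoissonSpace.MemDomD ν P F →
      -- the drop operator applied to `F` makes sense as a measurable function
      (∃ u, PoissonSpace.IsDropVersion P F u) ∧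
      -- and is given by its pathwise formula as soon as `η` is carried by its points
      ((∀ᵐ η ∂P, ∀ᵐ z ∂η.1, PoissonSpace.HasPoint η z) →
        PoissonSpace.IsDropVersion P F (PoissonSpace.dropOp F)) ∧
      -- the representation of the carré du champ
      ∀ u, PoissonSpace.IsDropVersion P F u →
        (∀ᵐ η ∂P, Integrable (fun z => (PoissonSpace.addOp F η z) ^ 2) ν) ∧
        (∀ᵐ η ∂P, Integrable (fun z => (u η z) ^ 2) η.1) ∧
        ∀ γ : PoissonSpace.Config Z → ℝ, PoissonSpace.IsCarreDuChamp ν P F γ ↔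
          γ =ᵐ[P] fun η => 1 / 2 * ∫ z, (PoissonSpace.addOp F η z) ^ 2 ∂ν
            + 1 / 2 * ∫ z, (u η z) ^ 2 ∂η.1 := by
  open PoissonSpace in
  have := hP.prob
  refine ⟨Set.Subset.antisymm (fun F hF => hF.1) fun F hF => ?_, fun F hF => ⟨?_, ?_, ?_⟩⟩
  · obtain ⟨v, hv, hvF⟩ := exists_measurable_eq_dropOp hF.1
    exact ⟨hF, _, isCarreDuChamp_of_dropOp hP hF hv hvF⟩
  · obtain ⟨v, hv, hvF⟩ := exists_measurable_eq_dropOp hF.1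
    exact ⟨fun η z => v (η, z), v, hv, hvF, by simp⟩
  · intro hpt
    obtain ⟨v, hv, hvF⟩ := exists_measurable_eq_dropOp hF.1
    refine ⟨v, hv, hvF, ?_⟩
    filter_upwards [hpt] with η hη
    filter_upwards [hη] with z hz
    exact (hvF η z hz).symm
  · rintro u ⟨v, hv, hvF, huv⟩
    have hone : ∀ᵐ η ∂P, |(fun _ => 1 : Config Z → ℝ) η| ≤ 1 := by simp
    have h2 := (integrable_and_integral_dropOp_sq_mul hP hF hv hvF measurable_const hone).1
    simp only [mul_one] at h2
    have hsq : ∀ᵐ η ∂P, (fun z => v (η, z) ^ 2) =ᵐ[η.1] fun z => u η z ^ 2 := by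
      filter_upwards [huv] with η hη
      filter_upwards [hη] with z hz
      rw [hz]
    have hγ := isCarreDuChamp_of_dropOp hP hF hv hvF
    have hγu := hγ.congr (γ' := fun η => 1 / 2 * ∫ z, addOp F η z ^ 2 ∂ν
      + 1 / 2 * ∫ z, u η z ^ 2 ∂η.1) (by
        filter_upwards [hsq] with η hη
        rw [integral_congr_ae hη])
    refine ⟨(hF.memLp_addOp hP).integrable_sq.prod_right_ae, ?_,
      fun γ => ⟨fun h => h.ae_eq hP hF hγu, fun h => hγu.congr h⟩⟩
    filter_upwards [h2, hsq] with η hη hη'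
    exact hη.congr hη'
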